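/- **Definitions.** Let $q$ be a prime power and $C\subseteq\mathbb{F}_q^n$ a linear code. Its dual is $C^\perp=\{v\in\mathbb{F}_q^n : c\cdot v=0 \text{ for all } c\in C\}$, and its minimum distance is the least Hamming weight of a nonzero codeword. The code $C$ has *locality* $r$ if $r$ is the least integer such that, for every coordinate $i$, there are a set $R\not\ni i$ of at most $r$ coordinates and a function $f$ with $c_i=f\big((c_j)_{j\in R}\big)$ for all $c\in C$. A linear code over $\mathbb{F}_q$ of length $n$, dimension $k$, minimum distance $d$ and locality $r$ is called an $(n,k,d,q;r)$-LRC. It is *distance-optimal* if it attains the Singleton-like bound, i.e. $d=n-k-\lceil k/r\rceil+2$, and *dimension-optimal* if it attains the Cadambe–Mazumdar bound, i.e. $$k=\min_{t\in\mathbb{Z}_{\ge 0}}\left\{tr+k_{\mathrm{opt}}^{(q)}(n-t(r+1),d)\right\},$$ where $k_{\mathrm{opt}}^{(q)}(n',d)$ is the largest dimension of a linear code over $\mathbb{F}_q$ of length $n'$ and minimum distance $d$ (and is $0$ if there is no such code, in particular if $n'\le 0$). Let $\beta\in\mathbb{F}_{q^2}$ be a primitive $(q+1)$-th root of unity. For an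 integer $0\le h\le q$ let $\mathcal{C}_{(q,q+1,3,h)}\subseteq\mathbb{F}_q^{q+1}$ be the BCH code of length $q+1$ and designed distance $3$: the cyclic code corresponding, under $(c_0,\dots,c_q)\leftrightarrow c_0+c_1x+\dots+c_qx^q$, to the ideal of $\mathbb{F}_q[x]/(x^{q+1}-1)$ generated by $\mathrm{lcm}(M_{\beta^h}(x),M_{\beta^{h+1}}(x))$, where $M_\gamma(x)$ is the minimal polynomial of $\gamma$ over $\mathbb{F}_q$. **Theorem.** Let $q$ be a prime power and $0\le h\le q$ with $h\notin\{0,\frac{q-1}{2},\frac q2,\frac{q+1}{2},q\}$. Suppose that $\gcd(2h+1,q+1)=1$ and $\max\{\gcd(2h,q+1),\gcd(2h+2,q+1)\}\ge 4$. Let $d^\perp$ be the minimum distance of $\mathcal{C}_{(q,q+1,3,h)}^\perp$. If $q>2h+2$, then $\mathcal{C}_{(q,q+1,3,h)}$ is a $(q+1,q-3,4,q;d^\perp-1)$-LRC and its dual $\mathcal{C}_{(q,q+1,3,h)}^\perp$ is a $(q+1,4,d^\perp,q;3)$-LRC. If moreover $q>4h$, then $\mathcal{C}_{(q,q+1,3,h)}$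 is both distance-optimal and dimension-optimal. -/

import Mathlib

open scoped Polynomial

noncomputable section

/-- The dual code: all vectors orthogonal to every codeword for the standard inner product. -/
def dualCode {F : Type*} [Field F] {n : ℕ} (C : Submodule F (Fin n → F)) :
    Submodule F (Fin n → F) where
  carrier := {v | ∀ c ∈ C, c ⬝ᵥ v = 0}
  add_mem' := by
    intro a b ha hb c hc
    rw [dotProduct_add, ha c hc, hb c hc, add_zero]
  zero_mem' := by
    intro c _
    exact dotProduct_zero c
  smul_mem' := by
    intro a v hv c hc
    rw [dotProduct_smul, hv c hc, smul_zero]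

/-- The set of Hamming weights of the nonzero codewords. -/
def nonzeroWeights {F : Type*} [Field F] [DecidableEq F] {n : ℕ}
    (C : Submodule F (Fin n → F)) : Set ℕ :=
  {w | ∃ c ∈ C, c ≠ 0 ∧ hammingNorm c = w}

/-- The code `C` is nonzero and has minimum distance `d`. -/
def HasMinDist {F : Type*} [Field F] [DecidableEq F] {n : ℕ}
    (C : Submodule F (Fin n → F)) (d : ℕ) : Prop :=
  IsLeast (nonzeroWeights C) d

/-- The linear map `(c₀, …, cₙ₋₁) ↦ c₀ + c₁ x + ⋯ + cₙ₋₁ xⁿ⁻¹` from `Fⁿ` to `F[x]/(xⁿ - 1)`. -/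
def wordToQuotient (F : Type*) [Field F] (n : ℕ) :
    (Fin n → F) →ₗ[F] (F[X] ⧸ Ideal.span {(Polynomial.X ^ n - 1 : F[X])}) :=
  (Ideal.Quotient.mkₐ F (Ideal.span {(Polynomial.X ^ n - 1 : F[X])})).toLinearMap ∘ₗ
    ∑ i : Fin n, (Polynomial.monomial (i : ℕ)) ∘ₗ (LinearMap.proj i)

/-- The cyclic code of length `n` generated by `g`: the vectors of `Fⁿ` that correspond to
elements of the ideal `⟨g⟩` of `F[x]/(xⁿ - 1)`. -/
def cyclicCode {F : Type*} [Field F] (n : ℕ) (g : F[X]) : Submodule F (Fin n → F) :=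
  ((Ideal.span {Ideal.Quotient.mk (Ideal.span {(Polynomial.X ^ n - 1 : F[X])}) g}).restrictScalars
    F).comap (wordToQuotient F n)

open scoped Classical in
/-- The monic least common multiple over `F` of the minimal polynomials of
`β ^ h, β ^ (h + 1), …, β ^ (h + δ - 2)`. -/
def bchGenerator (F : Type*) {K : Type*} [Field F] [Field K] [Algebra F K]
    (β : K) (δ h : ℕ) : F[X] :=
  (Finset.range (δ - 1)).lcm fun i => minpoly F (β ^ (h + i))

/-- The BCH code over `F` of length `n` and designed distance `δ` with offset `h`, with respect
to `β` (to be used with `β` a primitive `n`-th root of unity in an extension field of `F`). -/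
def bchCode (F : Type*) {K : Type*} [Field F] [Field K] [Algebra F K]
    (n : ℕ) (β : K) (δ h : ℕ) : Submodule F (Fin n → F) :=
  cyclicCode n (bchGenerator F β δ h)

/-- Every symbol of a codeword can be recovered from at most `r` other symbols of it: for each
coordinate `i` there are a set `R` of at most `r` other coordinates and a repair function. -/
def IsRepairableWith {F : Type*} [Field F] {n : ℕ} (C : Submodule F (Fin n → F)) (r : ℕ) : Prop :=
  ∀ i : Fin n, ∃ R : Finset (Fin n), i ∉ R ∧ R.card ≤ r ∧
    ∃ f : (R → F) → F, ∀ c ∈ C, c i = f fun j => c j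

/-- The locality of `C` is `r`: the least number of symbols that suffices for the repair. -/
def HasLocality {F : Type*} [Field F] {n : ℕ} (C : Submodule F (Fin n → F)) (r : ℕ) : Prop :=
  IsLeast {s | IsRepairableWith C s} r

/-- `C` is an `(n, k, d, q; r)`-LRC, where `n` is the length of `C` and `q` the size of `F`. -/
structure IsLRC {F : Type*} [Field F] [DecidableEq F] {n : ℕ}
    (C : Submodule F (Fin n → F)) (k d r : ℕ) : Prop where
  dimension : Module.finrank F C = k
  minDist : HasMinDist C d
  locality : HasLocality C r

/-- The largest dimension of a linear code over `F` of length `n` and minimum distance `d`;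
it is `0` if there is no such code. -/
def kOpt (F : Type*) [Field F] [DecidableEq F] (n d : ℕ) : ℕ :=
  sSup {k | ∃ C : Submodule F (Fin n → F), HasMinDist C d ∧ Module.finrank F C = k}

/-- `C` is an `(n, k, d, q; r)`-LRC whose distance attains the Singleton-like bound
`d ≤ n - k - ⌈k / r⌉ + 2`. -/
def IsDistanceOptimalLRC {F : Type*} [Field F] [DecidableEq F] {n : ℕ}
    (C : Submodule F (Fin n → F)) (k d r : ℕ) : Prop :=
  IsLRC C k d r ∧ (d : ℤ) = (n : ℤ) - (k : ℤ) - ⌈(k : ℚ) / (r : ℚ)⌉ + 2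

/-- `C` is an `(n, k, d, q; r)`-LRC whose dimension attains the Cadambe–Mazumdar bound
`k ≤ min_t (t r + k_opt (n - t (r + 1), d))`, `t` running over the nonnegative integers. For
`n < t (r + 1)` the truncated difference is `0`, and `k_opt (0, d) = 0` as it should be. -/
def IsDimensionOptimalLRC {F : Type*} [Field F] [DecidableEq F] {n : ℕ}
    (C : Submodule F (Fin n → F)) (k d r : ℕ) : Prop :=
  IsLRC C k d r ∧ IsLeast (Set.range fun t : ℕ => t * r + kOpt F (n - t * (r + 1)) d) k

end

/-! The code is the kernel of `bchSyndrome`, c ↦ (c(β^h), c(β^(h+1))), into K × K, which has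
dimension 4 over F. Everything rests on u^q = u⁻¹ for each power u of β.

Dual words are the functions u ↦ Tr(a u^h + b u^(h+1)); multiplied by u^(h+1), such a function
becomes a polynomial of degree at most 2h+2 (`card_zeros_le_of_ne_zero`). If 2h+2 < q, the syndrome
map is therefore onto, so the code has dimension q-3, and nonzero dual words have weight at least
q-1-2h.

Weight at most 3 is excluded by conjugating a three-term relation: the resulting 2×2 system has
determinant u^(2h+1) - v^(2h+1), nonzero by coprimality. Weight 4 occurs because, for a = h or h+1,
four points have u^a = ±1, so the syndrome imposes only three F-conditions on words supported there.

By cyclicity the locality is r = d' - 1, with d' the dual distance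
(`hasLocality_of_isShiftInvariant`). A word of weight 4 forces d' ≤ q-3, so q > 4h gives r < q-3 ≤
2r. Then ⌈(q-3)/r⌉ = 2, and a Reed–Solomon code settles t = 1 in the Cadambe–Mazumdar bound. -/

theorem dualCode_eq_orthogonal {F : Type*} [Field F] {n : ℕ} (C : Submodule F (Fin n → F)) :
    dualCode C = LinearMap.BilinForm.orthogonal (dotProductBilin F F) C := rfl

theorem dotProductBilin_nondegenerate (F : Type*) [Field F] (n : ℕ) :
    LinearMap.BilinForm.Nondegenerate (dotProductBilin F F : LinearMap.BilinForm F (Fin n → F)) :=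
  ⟨fun v hv => dotProduct_eq_zero v hv,
    fun v hv => dotProduct_eq_zero v fun w => (dotProduct_comm v w).trans (hv w)⟩

theorem dotProductBilin_isRefl (F : Type*) [Field F] (n : ℕ) :
    LinearMap.BilinForm.IsRefl (dotProductBilin F F : LinearMap.BilinForm F (Fin n → F)) :=
  fun v w h => (dotProduct_comm w v).trans h

theorem finrank_dualCode {F : Type*} [Field F] {n : ℕ} (C : Submodule F (Fin n → F)) :
    Module.finrank F (dualCode C) = n - Module.finrank F C := by
  rw [dualCode_eq_orthogonal,
    LinearMap.BilinForm.finrank_orthogonal (dotProductBilin_nondegenerate F n), Module.finrank_fin_fun]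

theorem dualCode_dualCode {F : Type*} [Field F] {n : ℕ} (C : Submodule F (Fin n → F)) :
    dualCode (dualCode C) = C :=
  LinearMap.BilinForm.orthogonal_orthogonal (dotProductBilin_nondegenerate F n)
    (dotProductBilin_isRefl F n) C

/-- A nonzero code has a minimum distance. -/
theorem exists_hasMinDist {F : Type*} [Field F] [DecidableEq F] {n : ℕ}
    {C : Submodule F (Fin n → F)} (hC : C ≠ ⊥) : ∃ d, HasMinDist C d := by
  obtain ⟨c, hc, h0⟩ := C.exists_mem_ne_zero_of_ne_bot hC
  have hne : (nonzeroWeights C).Nonempty := ⟨_, c, hc, h0, rfl⟩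
  exact ⟨sInf (nonzeroWeights C), Nat.sInf_mem hne, fun _ hw => Nat.sInf_le hw⟩

/-! ### Cyclic shifts and locality -/

/-- A code is invariant under all cyclic shifts. -/
def IsShiftInvariant {F : Type*} [Field F] {n : ℕ} [NeZero n] (C : Submodule F (Fin n → F)) :
    Prop :=
  ∀ c ∈ C, ∀ k : Fin n, (fun i => c (i + k)) ∈ C

theorem isShiftInvariant_dualCode {F : Type*} [Field F] {n : ℕ} [NeZero n]
    {C : Submodule F (Fin n → F)} (hC : IsShiftInvariant C) : IsShiftInvariant (dualCode C) := by
  intro v hv k c hc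
  rw [← hv _ (hC c hc (-k))]
  refine (Equiv.sum_comp (Equiv.addRight k) fun i => c (i + -k) * v i).symm.trans ?_ |>.symm
  simp [dotProduct]

/-- A set of coordinates that determines the symbol at `i` yields a dual codeword supported on
that set together with `i`. -/
theorem exists_mem_dualCode_of_repair {F : Type*} [Field F] {n : ℕ}
    {C : Submodule F (Fin n → F)} {i : Fin n} {R : Finset (Fin n)} (hi : i ∉ R)
    (h : ∀ c ∈ C, (∀ j ∈ R, c j = 0) → c i = 0) :
    ∃ v ∈ dualCode C, v i ≠ 0 ∧ ∀ j, j ∉ insert i R → v j = 0 := by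
  -- A functional vanishing on the common kernel of finitely many others is a combination of them;
  -- the coefficients give the dual word.
  have hspan : (LinearMap.proj i : (Fin n → F) →ₗ[F] F) ∘ₗ C.subtype ∈ Submodule.span F
      (Set.range fun j : R => (LinearMap.proj (j : Fin n) : (Fin n → F) →ₗ[F] F) ∘ₗ C.subtype) := by
    refine mem_span_of_iInf_ker_le_ker fun c hc => ?_
    simp only [Submodule.mem_iInf, LinearMap.mem_ker, LinearMap.comp_apply, Submodule.subtype_apply,
      LinearMap.proj_apply, Subtype.forall] at hc ⊢
    exact h c c.2 hc
  obtain ⟨a, ha⟩ := (Submodule.mem_span_range_iff_exists_fun F).1 hspan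
  classical
  refine ⟨fun j => if hj : j ∈ R then -a ⟨j, hj⟩ else if j = i then 1 else 0, ?_, by simp [hi], ?_⟩
  · intro c hc
    have hc' := LinearMap.congr_fun ha ⟨c, hc⟩
    simp only [LinearMap.sum_apply, LinearMap.smul_apply, LinearMap.comp_apply,
      Submodule.subtype_apply, LinearMap.proj_apply, smul_eq_mul] at hc'
    have hsplit : ∀ j, c j * (if hj : j ∈ R then -a ⟨j, hj⟩ else if j = i then 1 else 0) =
        (if hj : j ∈ R then -(a ⟨j, hj⟩ * c j) else 0) + (if j = i then c j else 0) := by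
      intro j
      by_cases hj : j ∈ R
      · have : j ≠ i := fun e => hi (e ▸ hj)
        simp [hj, this, mul_comm]
      · by_cases hji : j = i <;> simp [hj, hji, hi]
    simp only [dotProduct, hsplit, Finset.sum_add_distrib, Finset.sum_ite_eq', Finset.mem_univ,
      if_true]
    rw [← hc', ← Finset.sum_subset (Finset.subset_univ R) (fun j _ hj => by simp [hj]),
      ← Finset.sum_coe_sort R]
    simp
  · intro j hj
    simp only [Finset.mem_insert, not_or] at hj
    simp [hj.1, hj.2]

/-- The locality of a shift-invariant code is one less than the minimum distance of its dual. -/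
theorem hasLocality_of_isShiftInvariant {F : Type*} [Field F] [DecidableEq F] {n : ℕ} [NeZero n]
    {C : Submodule F (Fin n → F)} (hC : IsShiftInvariant C) {d : ℕ}
    (hd : HasMinDist (dualCode C) d) : HasLocality C (d - 1) := by
  constructor
  · obtain ⟨v, hv, hv0, hw⟩ := hd.1
    obtain ⟨k, hk⟩ := Function.ne_iff.1 hv0
    intro i
    obtain ⟨w, hwC, hwi, hwd⟩ : ∃ w ∈ dualCode C, w i ≠ 0 ∧ hammingNorm w = d := by
      refine ⟨_, isShiftInvariant_dualCode hC v hv (k - i), by simpa using hk, ?_⟩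
      rw [← hw]
      exact Finset.card_equiv (Equiv.addRight (k - i)) (by simp)
    refine ⟨Finset.univ.filter (fun j => w j ≠ 0) |>.erase i, by simp, ?_,
      fun x => -(w i)⁻¹ * ∑ j : (Finset.univ.filter fun j => w j ≠ 0).erase i, w j * x j, ?_⟩
    · rw [Finset.card_erase_of_mem (by simpa using hwi)]
      exact Nat.sub_le_sub_right hwd.le 1
    · intro c hc
      have h0 : ∑ j, c j * w j = 0 := hwC c hc
      rw [← Finset.sum_subset (Finset.subset_univ (Finset.univ.filter fun j => w j ≠ 0))
        (fun j _ hj => by simp at hj; simp [hj]),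
        ← Finset.add_sum_erase _ _ (by simpa using hwi : i ∈ Finset.univ.filter fun j => w j ≠ 0)]
        at h0
      dsimp only
      rw [Finset.sum_coe_sort (Finset.univ.filter (fun j => w j ≠ 0) |>.erase i)
        (fun j => w j * c j)]
      simp only [mul_comm (w _) (c _)]
      rw [eq_neg_of_add_eq_zero_right h0]
      field_simp
  · intro s hs
    obtain ⟨R, hiR, hR, f, hf⟩ := hs 0
    -- The repair function need not be linear; comparison with the zero codeword is enough.
    obtain ⟨v, hv, hvi, hvR⟩ := exists_mem_dualCode_of_repair hiR (C := C) fun c hc h => by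
      rw [hf c hc, show (fun j : R => c j) = fun j : R => (0 : Fin n → F) j from
        funext fun j => h j j.2, ← hf 0 C.zero_mem, Pi.zero_apply]
    have h1 : d ≤ hammingNorm v := hd.2 ⟨v, hv, fun e => hvi (by simp [e]), rfl⟩
    have h2 : hammingNorm v ≤ (insert (0 : Fin n) R).card :=
      Finset.card_le_card fun j hj => by
        by_contra h
        simp [hvR j h] at hj
    rw [Finset.card_insert_of_notMem hiR] at h2
    omega

/-! ### Singleton bound and Reed–Solomon codes -/

/-- The Singleton bound. -/
theorem HasMinDist.finrank_add_le {F : Type*} [Field F] [DecidableEq F] {n d : ℕ}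
    {C : Submodule F (Fin n → F)} (hd : HasMinDist C d) : Module.finrank F C + d ≤ n + 1 := by
  obtain ⟨c, hc, hc0, hcd⟩ := hd.1
  have hdn : d ≤ n := by
    have := hammingNorm_le_card_fintype (x := c)
    simpa [hcd] using this
  have hdpos : 0 < d := hcd ▸ hammingNorm_pos_iff.2 hc0
  -- A codeword vanishing on n+1-d coordinates has weight below d, so restriction to them is
  -- injective.
  let e : Fin (n + 1 - d) → Fin n := Fin.castLE (by omega)
  have he : Function.Injective e := Fin.castLE_injective _
  have hinj : Function.Injective ((LinearMap.funLeft F F e) ∘ₗ C.subtype) := by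
    rw [← LinearMap.ker_eq_bot, LinearMap.ker_eq_bot']
    rintro ⟨v, hv⟩ h
    by_contra hne
    have h1 : d ≤ hammingNorm v := hd.2 ⟨v, hv, fun h' => hne (Subtype.ext h'), rfl⟩
    have h2 : hammingNorm v ≤ ((Finset.univ.image e)ᶜ).card := Finset.card_le_card fun j hj => by
      simp only [Finset.mem_compl, Finset.mem_image, Finset.mem_univ, true_and]
      rintro ⟨k, rfl⟩
      simpa using (Finset.mem_filter.1 hj).2 (congrFun h k)
    rw [Finset.card_compl, Finset.card_image_of_injective _ he] at h2
    simp at h2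
    omega
  have := LinearMap.finrank_le_finrank_of_injective hinj
  rw [Module.finrank_fin_fun] at this
  omega

theorem bddAbove_finrank_of_hasMinDist (F : Type*) [Field F] [DecidableEq F] (n d : ℕ) :
    BddAbove {k | ∃ C : Submodule F (Fin n → F), HasMinDist C d ∧ Module.finrank F C = k} :=
  ⟨n, by rintro k ⟨C, -, rfl⟩; simpa using Submodule.finrank_le C⟩

theorem HasMinDist.finrank_le_kOpt {F : Type*} [Field F] [DecidableEq F] {n d : ℕ}
    {C : Submodule F (Fin n → F)} (hd : HasMinDist C d) : Module.finrank F C ≤ kOpt F n d :=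
  le_csSup (bddAbove_finrank_of_hasMinDist F n d) ⟨C, hd, rfl⟩

theorem kOpt_le (F : Type*) [Field F] [DecidableEq F] (n d : ℕ) : kOpt F n d ≤ n + 1 - d := by
  rcases Set.eq_empty_or_nonempty
    {k | ∃ C : Submodule F (Fin n → F), HasMinDist C d ∧ Module.finrank F C = k} with h | h
  · simp [kOpt, h]
  · refine csSup_le h ?_
    rintro k ⟨C, hC, rfl⟩
    have := hC.finrank_add_le
    omega

/-- Reed–Solomon codes attain the Singleton bound. -/
theorem kOpt_eq_of_le_card (F : Type*) [Field F] [Fintype F] [DecidableEq F] {n d : ℕ}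
    (hn : n ≤ Fintype.card F) (hd : 0 < d) (hdn : d ≤ n) : kOpt F n d = n + 1 - d := by
  refine (kOpt_le F n d).antisymm ?_
  obtain ⟨a⟩ : Nonempty (Fin n ↪ F) := Function.Embedding.nonempty_of_card_le (by simpa using hn)
  let ev : F[X] →ₗ[F] (Fin n → F) := LinearMap.pi fun i => Polynomial.leval (a i)
  have hev : ∀ p i, ev p i = p.eval (a i) := fun p i => rfl
  have hzeros : ∀ p : F[X], p ≠ 0 → p.natDegree ≤ n - d → d ≤ hammingNorm (ev p) := by
    intro p hp hdeg
    have h1 : (Finset.univ.filter fun i => ev p i = 0).card ≤ n - d := by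
      refine le_trans ?_ ((Polynomial.card_roots' p).trans hdeg)
      refine le_trans ?_ (Multiset.toFinset_card_le _)
      refine Finset.card_le_card_of_injOn a (fun i hi => ?_) a.injective.injOn
      simpa [hp, hev] using hi
    have h2 := Finset.card_filter_add_card_filter_not (s := Finset.univ) fun i => ev p i = 0
    rw [Finset.card_univ, Fintype.card_fin] at h2
    have h3 : hammingNorm (ev p) = (Finset.univ.filter fun i => ¬ ev p i = 0).card := by
      unfold hammingNorm
      congr
    omega
  have hlt : ∀ p ∈ Polynomial.degreeLT F (n + 1 - d), p ≠ 0 → p.natDegree ≤ n - d := by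
    intro p hp h0
    have := (Polynomial.natDegree_lt_iff_degree_lt h0).2 (Polynomial.mem_degreeLT.1 hp)
    omega
  have hmin : HasMinDist ((Polynomial.degreeLT F (n + 1 - d)).map ev) d := by
    constructor
    · let e : Fin (n - d) → Fin n := Fin.castLE (by omega)
      let p : F[X] := ∏ k, (Polynomial.X - Polynomial.C (a (e k)))
      have hp0 : p ≠ 0 := Finset.prod_ne_zero_iff.2 fun _ _ => Polynomial.X_sub_C_ne_zero _
      have hpdeg : p.natDegree = n - d := by
        simp [p]
      refine ⟨ev p, ⟨p, Polynomial.mem_degreeLT.2 ?_, rfl⟩, ?_, ?_⟩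
      · rw [← Polynomial.natDegree_lt_iff_degree_lt hp0]
        omega
      · rw [← hammingNorm_pos_iff]
        exact hd.trans_le (hzeros p hp0 hpdeg.le)
      · refine le_antisymm ?_ (hzeros p hp0 hpdeg.le)
        have : hammingNorm (ev p) ≤ ((Finset.univ.image e)ᶜ).card :=
          Finset.card_le_card fun j hj => by
            simp only [Finset.mem_compl, Finset.mem_image, Finset.mem_univ, true_and]
            rintro ⟨k, rfl⟩
            refine (Finset.mem_filter.1 hj).2 ?_
            rw [hev, Polynomial.eval_prod]
            exact Finset.prod_eq_zero (Finset.mem_univ k) (by simp)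
        rw [Finset.card_compl, Finset.card_image_of_injective _ (Fin.castLE_injective _)] at this
        simp at this
        omega
    · rintro w ⟨c, ⟨p, hp, rfl⟩, h0, rfl⟩
      have hp0 : p ≠ 0 := by
        rintro rfl
        exact h0 (map_zero ev)
      exact hzeros p hp0 (hlt p hp hp0)
  refine le_trans (le_of_eq ?_) hmin.finrank_le_kOpt
  have hinj : Function.Injective (ev.domRestrict (Polynomial.degreeLT F (n + 1 - d))) := by
    rw [← LinearMap.ker_eq_bot, LinearMap.ker_eq_bot']
    rintro ⟨p, hp⟩ h
    by_contra hne
    have hp0 : p ≠ 0 := fun h' => hne (Subtype.ext h')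
    have h1 := hzeros p hp0 (hlt p hp hp0)
    rw [show ev p = 0 from h, hammingNorm_zero] at h1
    omega
  rw [← LinearMap.range_domRestrict, LinearMap.finrank_range_of_inj hinj,
    (Polynomial.degreeLTEquiv F (n + 1 - d)).finrank_eq, Module.finrank_fin_fun]

/-! ### The BCH code as the kernel of two power sums -/

/-- Evaluation of the word `c₀, …, cₙ₋₁`, read as a polynomial, at a point of an extension. -/
noncomputable def wordEval (F : Type*) {K : Type*} [Field F] [Field K] [Algebra F K] (n : ℕ)
    (γ : K) : (Fin n → F) →ₗ[F] K :=
  Fintype.linearCombination F fun i : Fin n => γ ^ (i : ℕ)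

theorem wordEval_apply {F K : Type*} [Field F] [Field K] [Algebra F K] {n : ℕ} (γ : K)
    (c : Fin n → F) : wordEval F n γ c = ∑ i, c i • γ ^ (i : ℕ) := rfl

/-- The two power sums that cut out the BCH code of designed distance three. -/
noncomputable def bchSyndrome (F : Type*) {K : Type*} [Field F] [Field K] [Algebra F K] (n : ℕ)
    (β : K) (h : ℕ) : (Fin n → F) →ₗ[F] K × K :=
  (wordEval F n (β ^ h)).prod (wordEval F n (β ^ (h + 1)))

theorem mem_cyclicCode_iff_dvd {F : Type*} [Field F] {n : ℕ} {g : F[X]}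
    (hg : g ∣ Polynomial.X ^ n - 1) (c : Fin n → F) :
    c ∈ cyclicCode n g ↔ g ∣ ∑ i : Fin n, Polynomial.monomial (i : ℕ) (c i) := by
  have hw : wordToQuotient F n c = Ideal.Quotient.mk _
      (∑ i : Fin n, Polynomial.monomial (i : ℕ) (c i)) := by
    simp [wordToQuotient]
  simp only [cyclicCode, Submodule.mem_comap, Submodule.restrictScalars_mem, hw,
    Ideal.mem_span_singleton]
  constructor
  · rintro ⟨p, hp⟩
    obtain ⟨p, rfl⟩ := Ideal.Quotient.mk_surjective p
    rw [← map_mul, Ideal.Quotient.eq, Ideal.mem_span_singleton] at hp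
    exact (dvd_sub_left (dvd_mul_right g p)).1 (hg.trans hp)
  · exact map_dvd _

theorem bchCode_three_eq_ker {F K : Type*} [Field F] [Field K] [Algebra F K] {n : ℕ} {β : K}
    (hβ : β ^ n = 1) (h : ℕ) : bchCode F n β 3 h = LinearMap.ker (bchSyndrome F n β h) := by
  have hdvd : ∀ p : F[X], bchGenerator F β 3 h ∣ p ↔
      Polynomial.aeval (β ^ h) p = 0 ∧ Polynomial.aeval (β ^ (h + 1)) p = 0 := by
    intro p
    simp [bchGenerator, Finset.lcm_dvd_iff, Nat.le_one_iff_eq_zero_or_eq_one,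
      minpoly.dvd_iff]
  have hpow : ∀ k, Polynomial.aeval (β ^ k) (Polynomial.X ^ n - 1 : F[X]) = 0 := fun k => by
    simp [pow_right_comm β k n, hβ]
  ext c
  rw [bchCode, mem_cyclicCode_iff_dvd ((hdvd _).2 ⟨hpow _, hpow _⟩), hdvd]
  simp [bchSyndrome, wordEval_apply, Polynomial.aeval_monomial, Algebra.smul_def]

theorem mem_bchCode_three {F K : Type*} [Field F] [Field K] [Algebra F K] {n : ℕ} {β : K}
    (hβ : β ^ n = 1) {h : ℕ} {c : Fin n → F} : c ∈ bchCode F n β 3 h ↔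
      wordEval F n (β ^ h) c = 0 ∧ wordEval F n (β ^ (h + 1)) c = 0 := by
  rw [bchCode_three_eq_ker hβ]
  simp [bchSyndrome]

theorem wordEval_shift {F K : Type*} [Field F] [Field K] [Algebra F K] {n : ℕ} [NeZero n] {γ : K}
    (hγ : γ ^ n = 1) (c : Fin n → F) (k : Fin n) :
    γ ^ (k : ℕ) * wordEval F n γ (fun i => c (i + k)) = wordEval F n γ c := by
  rw [wordEval_apply, wordEval_apply, Finset.mul_sum,
    ← Equiv.sum_comp (Equiv.addRight k) fun i => c i • γ ^ (i : ℕ)]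
  refine Finset.sum_congr rfl fun i _ => ?_
  rw [Equiv.coe_addRight, Fin.val_add, mul_smul_comm, ← pow_add, ← pow_eq_pow_mod _ hγ, add_comm (k : ℕ)]

theorem isShiftInvariant_bchCode_three {F K : Type*} [Field F] [Field K] [Algebra F K] {n : ℕ}
    [NeZero n] {β : K} (hβ : β ^ n = 1) (h : ℕ) : IsShiftInvariant (bchCode F n β 3 h) := by
  have hβ0 : β ≠ 0 := by
    rintro rfl
    simp [NeZero.ne n] at hβ
  have key : ∀ (a : ℕ) (c : Fin n → F) (k : Fin n), wordEval F n (β ^ a) c = 0 →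
      wordEval F n (β ^ a) (fun i => c (i + k)) = 0 := fun a c k hc => by
    have := wordEval_shift (γ := β ^ a) (by rw [pow_right_comm, hβ, one_pow]) c k
    rw [hc] at this
    exact (mul_eq_zero.1 this).resolve_left (pow_ne_zero _ (pow_ne_zero _ hβ0))
  intro c hc k
  rw [mem_bchCode_three hβ] at hc ⊢
  exact ⟨key _ c k hc.1, key _ c k hc.2⟩

/-! ### No nonzero codewords of weight at most three -/

/-- Eliminating d leaves one equation in a(u-w) and b(v-w); applying σ, which inverts u, v, w,
supplies a second. -/
theorem eq_zero_of_three_term_power_sums {K : Type*} [Field K] (σ : K →+* K) {a b d u v w : K}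
    {h : ℕ} (ha : σ a = a) (hb : σ b = b) (hu : σ u = u⁻¹) (hv : σ v = v⁻¹)
    (hw : σ w = w⁻¹) (hu0 : u ≠ 0) (hv0 : v ≠ 0) (hw0 : w ≠ 0) (huw : u ≠ w) (hvw : v ≠ w)
    (huv : u ^ (2 * h + 1) ≠ v ^ (2 * h + 1)) (h₁ : a * u ^ h + b * v ^ h + d * w ^ h = 0)
    (h₂ : a * u ^ (h + 1) + b * v ^ (h + 1) + d * w ^ (h + 1) = 0) : a = 0 ∧ b = 0 := by
  have e₁ : a * (u - w) * u ^ h + b * (v - w) * v ^ h = 0 := by linear_combination h₂ - w * h₁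
  have e₂ : a * (u - w) * v ^ (h + 1) + b * (v - w) * u ^ (h + 1) = 0 := by
    have := congrArg σ e₁
    simp only [map_add, map_mul, map_sub, map_pow, ha, hb, hu, hv, hw, map_zero] at this
    calc a * (u - w) * v ^ (h + 1) + b * (v - w) * u ^ (h + 1) =
          -(u ^ (h + 1) * v ^ (h + 1) * w) *
            (a * (u⁻¹ - w⁻¹) * u⁻¹ ^ h + b * (v⁻¹ - w⁻¹) * v⁻¹ ^ h) := by
          simp only [inv_pow]
          field_simp
          ring
      _ = 0 := by rw [this, mul_zero]
  have hdet : u ^ (2 * h + 1) - v ^ (2 * h + 1) ≠ 0 := sub_ne_zero.2 huv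
  have hA : a * (u - w) * (u ^ (2 * h + 1) - v ^ (2 * h + 1)) = 0 := by
    linear_combination u ^ (h + 1) * e₁ - v ^ h * e₂
  have hB : b * (v - w) * (u ^ (2 * h + 1) - v ^ (2 * h + 1)) = 0 := by
    linear_combination u ^ h * e₂ - v ^ (h + 1) * e₁
  simpa [hdet, sub_ne_zero.2 huw, sub_ne_zero.2 hvw] using And.intro hA hB

theorem four_le_hammingNorm_of_mem_bchCode {F K : Type*} [Field F] [Fintype F] [DecidableEq F]
    [Field K] [Algebra F K] {β : K} {h : ℕ} (hβ : IsPrimitiveRoot β (Fintype.card F + 1))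
    (hgcd : Nat.gcd (2 * h + 1) (Fintype.card F + 1) = 1) {c : Fin (Fintype.card F + 1) → F}
    (hc : c ∈ bchCode F (Fintype.card F + 1) β 3 h) (hc0 : c ≠ 0) : 4 ≤ hammingNorm c := by
  have hcard : 2 ≤ Fintype.card F := Fintype.one_lt_card
  by_contra hlt
  -- Padding the support to exactly three points treats all small weights at once.
  obtain ⟨T, hT, hT3⟩ := Finset.exists_superset_card_eq
    (show hammingNorm c ≤ 3 by omega) (show 3 ≤ Fintype.card (Fin (Fintype.card F + 1)) by simp; omega)
  have hout : ∀ i, i ∉ T → c i = 0 := fun i hi => by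
    by_contra h0
    exact hi (hT (by simpa using h0))
  rw [mem_bchCode_three hβ.pow_eq_one] at hc
  have hsum : ∀ a, wordEval F _ (β ^ a) c = 0 →
      ∑ i ∈ T, algebraMap F K (c i) * (β ^ (i : ℕ)) ^ a = 0 := fun a h0 => by
    rw [← h0, wordEval_apply, ← Finset.sum_subset (Finset.subset_univ T)
      (fun i _ hi => by simp [hout i hi])]
    simp [Algebra.smul_def, pow_right_comm β a]
  obtain ⟨x, y, z, hxy, hxz, hyz, rfl⟩ := Finset.card_eq_three.1 hT3
  have h₁ := hsum _ hc.1
  have h₂ := hsum _ hc.2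
  have hβ0 : β ≠ 0 := hβ.ne_zero (by omega)
  let σ : K →+* K := (FiniteField.frobeniusAlgHom F K : K →+* K)
  have hσF : ∀ t : F, σ (algebraMap F K t) = algebraMap F K t :=
    (FiniteField.frobeniusAlgHom F K).commutes
  have hσβ : ∀ k : ℕ, σ (β ^ k) = (β ^ k)⁻¹ := fun k => by
    refine eq_inv_of_mul_eq_one_left ?_
    change (β ^ k) ^ Fintype.card F * β ^ k = 1
    rw [← pow_succ, pow_right_comm, hβ.pow_eq_one, one_pow]
  have hinj : ∀ {i j : Fin (Fintype.card F + 1)}, i ≠ j → β ^ (i : ℕ) ≠ β ^ (j : ℕ) :=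
    fun hij e => hij (Fin.ext (hβ.pow_inj (Fin.is_lt _) (Fin.is_lt _) e))
  have hinj' : ∀ {i j : Fin (Fintype.card F + 1)}, i ≠ j →
      (β ^ (i : ℕ)) ^ (2 * h + 1) ≠ (β ^ (j : ℕ)) ^ (2 * h + 1) := fun {i j} hij e => by
    rw [pow_right_comm, pow_right_comm β j] at e
    exact hij (Fin.ext ((hβ.pow_of_coprime _ hgcd).pow_inj (Fin.is_lt _) (Fin.is_lt _) e))
  have hzero : ∀ k : ℕ, β ^ k ≠ 0 := fun k => pow_ne_zero k hβ0
  rw [Finset.sum_insert (by simp [hxy, hxz]), Finset.sum_pair hyz, ← add_assoc] at h₁ h₂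
  have hab := eq_zero_of_three_term_power_sums σ (hσF _) (hσF _) (hσβ x) (hσβ y) (hσβ z) (hzero _)
    (hzero _) (hzero _) (hinj hxz) (hinj hyz) (hinj' hxy) h₁ h₂
  rw [hab.1, hab.2] at h₁
  simp only [zero_mul, zero_add, mul_eq_zero, pow_ne_zero h (hzero z), or_false, map_eq_zero]
    at h₁ hab
  refine hc0 (funext fun i => ?_)
  by_cases hi : i ∈ ({x, y, z} : Finset _)
  · simp only [Finset.mem_insert, Finset.mem_singleton] at hi
    rcases hi with rfl | rfl | rfl
    exacts [hab.1, hab.2, h₁]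
  · exact hout i hi

/-! ### Trace functions, dual weights and the dimension -/

theorem exists_trace_representation {F K : Type*} [Field F] [Finite F] [Field K] [Algebra F K]
    [FiniteDimensional F K] (l : K × K →ₗ[F] F) :
    ∃ a b : K, ∀ x y, l (x, y) = Algebra.trace F K (a * x + b * y) := by
  let B := (Algebra.traceForm F K).toDual (traceForm_nondegenerate F K)
  refine ⟨B.symm (l ∘ₗ LinearMap.inl F K K), B.symm (l ∘ₗ LinearMap.inr F K K), fun x y => ?_⟩
  have h₁ := LinearMap.BilinForm.apply_toDual_symm_apply
    (hB := traceForm_nondegenerate F K) (l ∘ₗ LinearMap.inl F K K) x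
  have h₂ := LinearMap.BilinForm.apply_toDual_symm_apply
    (hB := traceForm_nondegenerate F K) (l ∘ₗ LinearMap.inr F K K) y
  rw [Algebra.traceForm_apply] at h₁ h₂
  rw [map_add, h₁, h₂]
  simp [← map_add]

theorem card_zeros_le_of_ne_zero {F K : Type*} [Field F] [Fintype F] [DecidableEq F]
    [Field K] [Algebra F K] (hK : Module.finrank F K = 2) {β : K} {h : ℕ} (hh : h ≠ 0)
    (hβ : IsPrimitiveRoot β (Fintype.card F + 1)) {l : K × K →ₗ[F] F} (hl : l ≠ 0) :
    (Finset.univ.filter fun i : Fin (Fintype.card F + 1) =>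
      l ((β ^ h) ^ (i : ℕ), (β ^ (h + 1)) ^ (i : ℕ)) = 0).card ≤ 2 * h + 2 := by
  classical
  have : FiniteDimensional F K := Module.finite_of_finrank_eq_succ hK
  have : Finite K := Module.finite_of_finite F
  obtain ⟨a, b, hab⟩ := exists_trace_representation l
  -- This is u^(h+1) · Tr(a u^h + b u^(h+1)), using Tr x = x + x^q and u^q = u⁻¹. Since h ≠ 0, the
  -- coefficients a and b stand alone in their degrees.
  let P : K[X] := .C b * .X ^ (2 * h + 2) + .C a * .X ^ (2 * h + 1) +
    .C (a ^ Fintype.card F) * .X + .C (b ^ Fintype.card F)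
  have hP0 : P ≠ 0 := by
    intro h0
    have hb : b = 0 := by
      simpa [P, Polynomial.coeff_X, Polynomial.coeff_C, -map_pow] using
        congrArg (Polynomial.coeff · (2 * h + 2)) h0
    have ha : a = 0 := by
      simpa [P, Polynomial.coeff_X, Polynomial.coeff_C, hh, -map_pow] using
        congrArg (Polynomial.coeff · (2 * h + 1)) h0
    refine hl (LinearMap.ext fun ⟨x, y⟩ => ?_)
    rw [hab, ha, hb]
    simp
  have hdeg : P.natDegree ≤ 2 * h + 2 := by
    simp only [P]
    compute_degree
  refine le_trans ?_ ((Polynomial.card_roots' P).trans hdeg)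
  refine le_trans ?_ (Multiset.toFinset_card_le _)
  refine Finset.card_le_card_of_injOn (fun i => β ^ (i : ℕ)) (fun i hi => ?_)
    fun i _ j _ e => Fin.ext (hβ.pow_inj i.2 j.2 e)
  have hβ0 : β ≠ 0 := hβ.ne_zero (by omega)
  set u := β ^ (i : ℕ) with hu
  have hu0 : u ≠ 0 := pow_ne_zero _ hβ0
  have huq : u ^ Fintype.card F * u = 1 := by
    rw [← pow_succ, hu, pow_right_comm, hβ.pow_eq_one, one_pow]
  have hz : a * u ^ h + b * u ^ (h + 1) + (a * u ^ h + b * u ^ (h + 1)) ^ Fintype.card F = 0 := by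
    have h0 : l ((β ^ h) ^ (i : ℕ), (β ^ (h + 1)) ^ (i : ℕ)) = 0 := by simpa using hi
    have h1 := FiniteField.algebraMap_trace_eq_sum_pow F K (a * u ^ h + b * u ^ (h + 1))
    rw [hK, Finset.sum_range_succ, Finset.sum_range_one, pow_zero, pow_one, pow_one,
      Nat.card_eq_fintype_card] at h1
    rw [← h1, hu, pow_right_comm β i, pow_right_comm β i, ← hab, h0, map_zero]
  have hfrob : (a * u ^ h + b * u ^ (h + 1)) ^ Fintype.card F =
      a ^ Fintype.card F * (u ^ Fintype.card F) ^ h +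
        b ^ Fintype.card F * (u ^ Fintype.card F) ^ (h + 1) := by
    clear_value u
    change FiniteField.frobeniusAlgHom F K _ = _
    rw [map_add, map_mul, map_mul, map_pow, map_pow]
    rfl
  have hinv : ∀ k, (u ^ Fintype.card F) ^ k * u ^ k = 1 := fun k => by
    rw [← mul_pow, huq, one_pow]
  simp only [Finset.mem_coe, Multiset.mem_toFinset, Polynomial.mem_roots hP0, Polynomial.IsRoot]
  simp only [P, Polynomial.eval_add, Polynomial.eval_mul, Polynomial.eval_C, Polynomial.eval_pow,
    Polynomial.eval_X]
  rw [hfrob] at hz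
  linear_combination u ^ (h + 1) * hz - a ^ Fintype.card F * u * hinv h -
    b ^ Fintype.card F * hinv (h + 1)

theorem bchSyndrome_single {F K : Type*} [Field F] [Field K] [Algebra F K] {n : ℕ} (β : K) (h : ℕ)
    (i : Fin n) : bchSyndrome F n β h (Pi.single i 1) =
      ((β ^ h) ^ (i : ℕ), (β ^ (h + 1)) ^ (i : ℕ)) := by
  simp [bchSyndrome, wordEval, Fintype.linearCombination_apply_single]

/-- Pairing with a dual word kills the kernel of the syndrome map, hence factors through that map.
-/
theorem exists_functional_of_mem_dualCode {F K : Type*} [Field F] [Field K] [Algebra F K] {n : ℕ}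
    {β : K} (hβ : β ^ n = 1) {h : ℕ} {v : Fin n → F} (hv : v ∈ dualCode (bchCode F n β 3 h)) :
    ∃ l : K × K →ₗ[F] F, ∀ i, v i = l ((β ^ h) ^ (i : ℕ), (β ^ (h + 1)) ^ (i : ℕ)) := by
  have hmem : dotProductBilin F F v ∈ (LinearMap.ker (bchSyndrome F n β h)).dualAnnihilator := by
    rw [Submodule.mem_dualAnnihilator, ← bchCode_three_eq_ker hβ]
    intro c hc
    exact (dotProduct_comm v c).trans (hv c hc)
  rw [← LinearMap.range_dualMap_eq_dualAnnihilator_ker] at hmem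
  obtain ⟨l, hl⟩ := hmem
  refine ⟨l, fun i => ?_⟩
  have := LinearMap.congr_fun hl (Pi.single i 1)
  rw [LinearMap.dualMap_apply, bchSyndrome_single] at this
  rw [this]
  exact (dotProduct_single_one v i).symm

theorem card_le_hammingNorm_add_of_mem_dualCode_bchCode {F K : Type*} [Field F] [Fintype F]
    [DecidableEq F] [Field K] [Algebra F K] (hK : Module.finrank F K = 2) {β : K} {h : ℕ}
    (hh : h ≠ 0) (hβ : IsPrimitiveRoot β (Fintype.card F + 1)) {v : Fin (Fintype.card F + 1) → F}
    (hv : v ∈ dualCode (bchCode F (Fintype.card F + 1) β 3 h)) (hv0 : v ≠ 0) :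
    Fintype.card F + 1 ≤ hammingNorm v + (2 * h + 2) := by
  obtain ⟨l, hl⟩ := exists_functional_of_mem_dualCode hβ.pow_eq_one hv
  have hl0 : l ≠ 0 := by
    rintro rfl
    exact hv0 (funext hl)
  have h1 := card_zeros_le_of_ne_zero hK hh hβ hl0
  simp only [← hl] at h1
  have h2 := Finset.card_filter_add_card_filter_not (s := Finset.univ) fun i => v i = 0
  have h3 : hammingNorm v = (Finset.univ.filter fun i => ¬ v i = 0).card := by
    unfold hammingNorm
    congr
  rw [Finset.card_univ, Fintype.card_fin] at h2
  omega

theorem finrank_bchCode_three {F K : Type*} [Field F] [Fintype F] [DecidableEq F] [Field K]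
    [Algebra F K] (hK : Module.finrank F K = 2) {β : K} {h : ℕ} (hh : h ≠ 0)
    (hβ : IsPrimitiveRoot β (Fintype.card F + 1)) (hlt : 2 * h + 2 < Fintype.card F) :
    Module.finrank F (bchCode F (Fintype.card F + 1) β 3 h) = Fintype.card F - 3 := by
  have : FiniteDimensional F K := Module.finite_of_finrank_eq_succ hK
  have hsurj : LinearMap.range (bchSyndrome F (Fintype.card F + 1) β h) = ⊤ := by
    by_contra hne
    -- A proper image would give a nonzero functional with q+1 > 2h+2 zeros.
    obtain ⟨l, hl0, hl⟩ := Submodule.exists_le_ker_of_lt_top _ (lt_top_iff_ne_top.2 hne)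
    have h1 := card_zeros_le_of_ne_zero hK hh hβ hl0
    rw [Finset.filter_true_of_mem fun i _ => by
      rw [← bchSyndrome_single (F := F)]
      exact hl ⟨_, rfl⟩, Finset.card_univ, Fintype.card_fin] at h1
    omega
  have := LinearMap.finrank_range_add_finrank_ker (bchSyndrome F (Fintype.card F + 1) β h)
  rw [hsurj, finrank_top, Module.finrank_prod, hK, Module.finrank_fin_fun,
    ← bchCode_three_eq_ker hβ.pow_eq_one] at this
  omega

/-! ### Codewords of weight four -/

/-- If the `a`-th powers of four of the evaluation points are `±1`, then some nonzero word supported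
on these points has vanishing `a`-th and `b`-th power sums. -/
theorem exists_word_supported_on_four {F K : Type*} [Field F] [Field K] [Algebra F K]
    (hK : Module.finrank F K = 2) {n : ℕ} (β : K) (a b : ℕ) {S : Finset (Fin n)}
    (hS : S.card = 4) (ha : ∀ i ∈ S, ((β ^ a) ^ (i : ℕ)) ^ 2 = 1) :
    ∃ c : Fin n → F, c ≠ 0 ∧ (∀ i, i ∉ S → c i = 0) ∧ wordEval F n (β ^ a) c = 0 ∧
      wordEval F n (β ^ b) c = 0 := by
  classical
  have : FiniteDimensional F K := Module.finite_of_finrank_eq_succ hK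
  have hs : ∀ i, ∃ s : F, i ∈ S → algebraMap F K s = (β ^ a) ^ (i : ℕ) := fun i => by
    by_cases hi : i ∈ S
    · rcases sq_eq_one_iff.1 (ha i hi) with h | h
      · exact ⟨1, fun _ => by simp [h]⟩
      · exact ⟨-1, fun _ => by simp [h]⟩
    · exact ⟨0, fun h => absurd h hi⟩
  choose s hs using hs
  -- The signs lie in F, so the target has dimension 1 + 2 + (n-4) < n.
  let f : (Fin n → F) →ₗ[F] (F × K) × ({i // i ∉ S} → F) :=
    ((Fintype.linearCombination F s).prod (wordEval F n (β ^ b))).prod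
      (LinearMap.funLeft F F Subtype.val)
  have hn : 4 ≤ n := by
    simpa [hS] using Finset.card_le_univ S
  have hker : LinearMap.ker f ≠ ⊥ := by
    apply LinearMap.ker_ne_bot_of_finrank_lt
    rw [Module.finrank_prod, Module.finrank_prod, Module.finrank_self, hK,
      Module.finrank_fintype_fun_eq_card, Module.finrank_fin_fun,
      Fintype.card_subtype_compl, Fintype.card_fin, Fintype.card_coe, hS]
    omega
  obtain ⟨c, hc, hc0⟩ := Submodule.exists_mem_ne_zero_of_ne_bot hker
  have hs0 : Fintype.linearCombination F s c = 0 := congrArg (fun x => x.1.1) hc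
  have hb0 : wordEval F n (β ^ b) c = 0 := congrArg (fun x => x.1.2) hc
  have hout : ∀ i, i ∉ S → c i = 0 := fun i hi => congrFun (congrArg Prod.snd hc) ⟨i, hi⟩
  refine ⟨c, hc0, hout, ?_, hb0⟩
  rw [← map_zero (algebraMap F K), ← hs0, Fintype.linearCombination_apply, wordEval_apply,
    map_sum]
  refine Finset.sum_congr rfl fun i _ => ?_
  by_cases hi : i ∈ S
  · rw [smul_eq_mul, map_mul, hs i hi, Algebra.smul_def]
  · simp [hout i hi]

/-- With g = gcd(2a, n), the multiples k·(n/g) for k < 4 ≤ g are distinct exponents below n, and n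
divides 2a·(n/g). -/
theorem exists_four_points {K : Type*} [Field K] {n : ℕ} {β : K} (hβ : β ^ n = 1)
    (hn : 0 < n) {a : ℕ} (ha : 4 ≤ Nat.gcd (2 * a) n) :
    ∃ S : Finset (Fin n), S.card = 4 ∧ ∀ i ∈ S, ((β ^ a) ^ (i : ℕ)) ^ 2 = 1 := by
  obtain ⟨m, hm⟩ := Nat.gcd_dvd_right (2 * a) n
  obtain ⟨t, ht⟩ := Nat.gcd_dvd_left (2 * a) n
  have hm0 : 0 < m := Nat.pos_of_ne_zero fun h => by simp [h] at hm; omega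
  have hlt : ∀ k : Fin 4, (k : ℕ) * m < n := fun k => by
    calc (k : ℕ) * m < Nat.gcd (2 * a) n * m :=
          Nat.mul_lt_mul_of_pos_right (k.2.trans_le ha) hm0
      _ = n := hm.symm
  have hinj : Function.Injective fun k : Fin 4 => (⟨k * m, hlt k⟩ : Fin n) := fun j k h =>
    Fin.ext (Nat.eq_of_mul_eq_mul_right hm0 (Fin.mk.inj_iff.1 h))
  refine ⟨Finset.univ.map ⟨_, hinj⟩, by simp, fun i hi => ?_⟩
  obtain ⟨k, -, rfl⟩ := Finset.mem_map.1 hi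
  change ((β ^ a) ^ ((k : ℕ) * m)) ^ 2 = 1
  rw [← pow_mul, ← pow_mul, show a * (k * m * 2) = n * (t * k) by
    calc a * (k * m * 2) = 2 * a * m * k := by ring
      _ = Nat.gcd (2 * a) n * t * m * k := by rw [← ht]
      _ = Nat.gcd (2 * a) n * m * (t * k) := by ring
      _ = n * (t * k) := by rw [← hm], pow_mul, hβ, one_pow]

theorem hasMinDist_bchCode_three {F K : Type*} [Field F] [Fintype F] [DecidableEq F] [Field K]
    [Algebra F K] (hK : Module.finrank F K = 2) {β : K} {h : ℕ}
    (hβ : IsPrimitiveRoot β (Fintype.card F + 1))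
    (hgcd : Nat.gcd (2 * h + 1) (Fintype.card F + 1) = 1)
    (hm : 4 ≤ max (Nat.gcd (2 * h) (Fintype.card F + 1))
      (Nat.gcd (2 * h + 2) (Fintype.card F + 1))) :
    HasMinDist (bchCode F (Fintype.card F + 1) β 3 h) 4 := by
  have hex : ∃ S : Finset (Fin (Fintype.card F + 1)), S.card = 4 ∧
      ∃ c ∈ bchCode F (Fintype.card F + 1) β 3 h, c ≠ 0 ∧ ∀ i, i ∉ S → c i = 0 := by
    simp only [mem_bchCode_three hβ.pow_eq_one]
    rcases le_max_iff.1 hm with hm | hm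
    · obtain ⟨S, hS, hpow⟩ := exists_four_points hβ.pow_eq_one (Nat.succ_pos _) hm
      obtain ⟨c, h0, hout, h1, h2⟩ := exists_word_supported_on_four (F := F) hK β h (h + 1) hS hpow
      exact ⟨S, hS, c, ⟨h1, h2⟩, h0, hout⟩
    · obtain ⟨S, hS, hpow⟩ := exists_four_points (a := h + 1) hβ.pow_eq_one (Nat.succ_pos _) hm
      obtain ⟨c, h0, hout, h1, h2⟩ := exists_word_supported_on_four (F := F) hK β (h + 1) h hS hpow
      exact ⟨S, hS, c, ⟨h2, h1⟩, h0, hout⟩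
  constructor
  · obtain ⟨S, hS, c, hc, h0, hout⟩ := hex
    refine ⟨c, hc, h0, le_antisymm ?_ (four_le_hammingNorm_of_mem_bchCode hβ hgcd hc h0)⟩
    rw [← hS]
    exact Finset.card_le_card fun i hi => by
      by_contra h
      simp [hout i h] at hi
  · rintro w ⟨c, hc, h0, rfl⟩
    exact four_le_hammingNorm_of_mem_bchCode hβ hgcd hc h0

/-! ### Upper bound on the dual distance, and optimality -/

/-- Codewords of weight `d` in a code of codimension at least `d` force dual codewords of weight at
most `n - d`. -/
theorem exists_mem_dualCode_hammingNorm_add_le {F : Type*} [Field F] [DecidableEq F] {n d : ℕ}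
    {C : Submodule F (Fin n → F)} {c : Fin n → F} (hc : c ∈ C) (hc0 : c ≠ 0)
    (hd : hammingNorm c = d) (hdim : d ≤ Module.finrank F (dualCode C)) :
    ∃ v ∈ dualCode C, v ≠ 0 ∧ hammingNorm v + d ≤ n := by
  obtain ⟨i, hi⟩ := Function.ne_iff.1 hc0
  set S := Finset.univ.filter fun j => c j ≠ 0 with hS
  have hiS : i ∈ S := by simpa [hS] using hi
  have hSd : S.card = d := by
    rw [← hd]
    unfold hammingNorm
    congr
  -- Only d-1 zeros on the support of c are imposed; orthogonality to c forces the last one.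
  let f : dualCode C →ₗ[F] ({j // j ∈ S.erase i} → F) :=
    LinearMap.funLeft F F Subtype.val ∘ₗ (dualCode C).subtype
  have hker : LinearMap.ker f ≠ ⊥ := by
    apply LinearMap.ker_ne_bot_of_finrank_lt
    have := Finset.card_pos.2 ⟨i, hiS⟩
    rw [Module.finrank_fintype_fun_eq_card, Fintype.card_coe, Finset.card_erase_of_mem hiS]
    omega
  obtain ⟨⟨v, hv⟩, hvf, hv0⟩ := Submodule.exists_mem_ne_zero_of_ne_bot hker
  have hz : ∀ j ∈ S.erase i, v j = 0 := fun j hj => congrFun (LinearMap.mem_ker.1 hvf) ⟨j, hj⟩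
  have hdot : c ⬝ᵥ v = 0 := hv c hc
  have hvi : v i = 0 := by
    rw [dotProduct, Finset.sum_eq_single i] at hdot
    · exact (mul_eq_zero.1 hdot).resolve_left hi
    · intro j _ hji
      by_cases hj : j ∈ S
      · simp [hz j (Finset.mem_erase.2 ⟨hji, hj⟩)]
      · have : c j = 0 := by simpa [hS] using hj
        simp [this]
    · simp
  refine ⟨v, hv, fun h => hv0 (Subtype.ext h), ?_⟩
  have h1 : hammingNorm v ≤ Sᶜ.card := Finset.card_le_card fun j hj => by
    rw [Finset.mem_compl]
    intro hjS
    refine (Finset.mem_filter.1 hj).2 ?_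
    rcases eq_or_ne j i with rfl | hji
    · exact hvi
    · exact hz j (Finset.mem_erase.2 ⟨hji, hjS⟩)
  have h2 := S.card_add_card_compl
  rw [Fintype.card_fin] at h2
  omega

theorem isLRC_of_isShiftInvariant {F : Type*} [Field F] [DecidableEq F] {n : ℕ} [NeZero n]
    {C : Submodule F (Fin n → F)} (hC : IsShiftInvariant C) {k d d' : ℕ}
    (hk : Module.finrank F C = k) (hd : HasMinDist C d) (hd' : HasMinDist (dualCode C) d') :
    IsLRC C k d (d' - 1) :=
  ⟨hk, hd, hasLocality_of_isShiftInvariant hC hd'⟩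

/-- An LRC of distance four and codimension four whose locality lies in the range where the
Singleton-like bound forces two repair groups attains this bound. -/
theorem IsLRC.isDistanceOptimal {F : Type*} [Field F] [DecidableEq F] {q r : ℕ}
    {C : Submodule F (Fin (q + 1) → F)} (hC : IsLRC C (q - 3) 4 r) (hr : r < q - 3)
    (hr2 : q - 3 ≤ 2 * r) : IsDistanceOptimalLRC C (q - 3) 4 r := by
  refine ⟨hC, ?_⟩
  have hr0 : (0 : ℚ) < r := by
    have : 0 < r := by omega
    exact_mod_cast this
  have hceil : ⌈((q - 3 : ℕ) : ℚ) / (r : ℚ)⌉ = 2 := by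
    rw [Int.ceil_eq_iff]
    constructor
    · rw [lt_div_iff₀ hr0]
      have : (r : ℚ) < (q - 3 : ℕ) := by exact_mod_cast hr
      push_cast
      linarith
    · rw [div_le_iff₀ hr0]
      exact_mod_cast hr2
  rw [hceil]
  push_cast [show 3 ≤ q by omega]
  ring

theorem IsLRC.isDimensionOptimal {F : Type*} [Field F] [Fintype F] [DecidableEq F] {r : ℕ}
    {C : Submodule F (Fin (Fintype.card F + 1) → F)} (hC : IsLRC C (Fintype.card F - 3) 4 r)
    (hr : r < Fintype.card F - 3) (hr2 : Fintype.card F - 3 ≤ 2 * r) :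
    IsDimensionOptimalLRC C (Fintype.card F - 3) 4 r := by
  -- The remaining length q-r is at most q and at least 4, so Reed–Solomon codes give dimension
  -- q-r-3.
  have hone : 1 * r + kOpt F (Fintype.card F + 1 - 1 * (r + 1)) 4 = Fintype.card F - 3 := by
    rw [kOpt_eq_of_le_card F (by omega) (by omega) (by omega)]
    omega
  refine ⟨hC, ⟨1, hone⟩, ?_⟩
  rintro _ ⟨t, rfl⟩
  dsimp only
  rcases t with _ | _ | t
  · have := hC.minDist.finrank_le_kOpt
    rw [hC.dimension] at this
    simpa using this
  · exact hone.ge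
  · have : 2 * r ≤ (t + 1 + 1) * r := Nat.mul_le_mul_right r (by omega)
    omega

theorem mainTheorem8 {F K : Type*} [Field F] [Fintype F] [DecidableEq F] [Field K] [Algebra F K]
    (q h : ℕ) (hq : Fintype.card F = q) (hK : Module.finrank F K = 2)
    (β : K) (hβ : IsPrimitiveRoot β (q + 1))
    (hhq : h ≤ q) (h_ne_zero : h ≠ 0) (h_ne_half_pred : 2 * h + 1 ≠ q) (h_ne_half : 2 * h ≠ q)
    (h_ne_half_succ : 2 * h ≠ q + 1) (h_ne_q : h ≠ q)
    (hgcd : Nat.gcd (2 * h + 1) (q + 1) = 1)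
    (hm : 4 ≤ max (Nat.gcd (2 * h) (q + 1)) (Nat.gcd (2 * h + 2) (q + 1)))
    (hqh : 2 * h + 2 < q) :
    ∃ d' : ℕ, HasMinDist (dualCode (bchCode F (q + 1) β 3 h)) d' ∧
      IsLRC (bchCode F (q + 1) β 3 h) (q - 3) 4 (d' - 1) ∧
      IsLRC (dualCode (bchCode F (q + 1) β 3 h)) 4 d' 3 ∧
      (4 * h < q →
        IsDistanceOptimalLRC (bchCode F (q + 1) β 3 h) (q - 3) 4 (d' - 1) ∧
        IsDimensionOptimalLRC (bchCode F (q + 1) β 3 h) (q - 3) 4 (d' - 1)) := by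
  subst hq
  have hinv := isShiftInvariant_bchCode_three (F := F) hβ.pow_eq_one h
  have hdim := finrank_bchCode_three hK h_ne_zero hβ hqh
  have hmin := hasMinDist_bchCode_three hK hβ hgcd hm
  have hdual : Module.finrank F (dualCode (bchCode F (Fintype.card F + 1) β 3 h)) = 4 := by
    rw [finrank_dualCode, hdim]
    omega
  obtain ⟨d', hd'⟩ := exists_hasMinDist
    (C := dualCode (bchCode F (Fintype.card F + 1) β 3 h)) fun e => by
      rw [e, finrank_bot] at hdual
      omega
  have hLRC := isLRC_of_isShiftInvariant hinv hdim hmin hd'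
  refine ⟨d', hd', hLRC, isLRC_of_isShiftInvariant (isShiftInvariant_dualCode hinv) hdual hd'
    (by rwa [dualCode_dualCode]), fun hq4 => ?_⟩
  -- With r = d'-1, this gives r ≥ q-2-2h, hence 2r ≥ q-3 as q > 4h; `hup` gives r ≤ q-4.
  have hlow : Fintype.card F + 1 ≤ d' + (2 * h + 2) := by
    obtain ⟨v, hv, hv0, rfl⟩ := hd'.1
    exact card_le_hammingNorm_add_of_mem_dualCode_bchCode hK h_ne_zero hβ hv hv0
  have hup : d' + 4 ≤ Fintype.card F + 1 := by
    obtain ⟨c, hc, hc0, hc4⟩ := hmin.1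
    obtain ⟨v, hv, hv0, hvn⟩ := exists_mem_dualCode_hammingNorm_add_le hc hc0 hc4 hdual.ge
    have := hd'.2 ⟨v, hv, hv0, rfl⟩
    omega
  exact ⟨hLRC.isDistanceOptimal (by omega) (by omega),
    hLRC.isDimensionOptimal (by omega) (by omega)⟩
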